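/- Let $d,m,N\ge 1$ be integers, let $A_1,\dots,A_N\in\mathbb R^{d\times d}$ and $B\in\mathbb R^{d\times m}$ be real matrices, and let $0<\Lambda_1<\dots<\Lambda_N$ be real delays. Let $M(\mathbb R_-)$ be the set of real Radon measures on $\mathbb R$ whose support is a compact subset of $\mathbb R_-=(-\infty,0]$, let $*$ denote convolution (for matrices of measures: the matrix product in which entries are multiplied by convolution), and let $\delta_a$ be the Dirac mass at $a$. Put $$Q=\delta_{-\Lambda_N}I_d-\sum_{j=1}^N\delta_{-\Lambda_N+\Lambda_j}A_j,\qquad P=\delta_0 B .$$ Let $\Omega_1$ be the set of $u\in L^1(\mathbb R_-,\mathbb R^m)$ with compact (essential) support, extended by $0$ to $\mathbb R$. For $u\in\Omega_1$ let $x\in L^1_{\rm loc}(\mathbb R,\mathbb R^d)$ be the solution of $$x(t)=\sum_{j=1}^N A_j x(t-\Lambda_j)+Bu(t)\ \text{ for a.e. } t\ge\inf\operatorname{supp}(u),\qquad x(t)=0\ \text{ for a.e. } t<\inf\operatorname{supp}(u)$$ (with $\inf\emptyset=+\infty$), and let $y(t)=x(t-\Lambda_N)$, $t\ge 0$, be the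 associated output. Let $$X^{Q,1}=\{y\in L^1_{\rm loc}(\mathbb R_+,\mathbb R^d) : (Q*y)(t)=0\ \text{for a.e. } t>0\},$$ where $y$ is extended by $0$ to negative times in the convolution. The system is called $L^1$ exactly controllable if for every $\phi\in X^{Q,1}$ there is $u\in\Omega_1$ whose associated output satisfies $y=\phi$ a.e. on $[0,+\infty)$. Theorem. The system is $L^1$ exactly controllable if and only if there exist a $d\times d$ matrix $R$ and an $m\times d$ matrix $S$ with entries in $M(\mathbb R_-)$ such that $$Q*R+P*S=\delta_0 I_d .$$ -/

import Mathlib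

open MeasureTheory Matrix

noncomputable section

namespace DelayControl

/-! ### Compactly supported real Radon measures and convolution -/

/-- `μ` belongs to `M(ℝ₋)`: a real Radon measure whose support is a compact subset of `(-∞, 0]`.
(A compactly supported real Radon measure on `ℝ` is the same thing as a finite signed Borel
measure with compact support; the support is that of the total variation.) -/
def MemMNeg (μ : SignedMeasure ℝ) : Prop :=
  IsCompact μ.totalVariation.support ∧ μ.totalVariation.support ⊆ Set.Iic 0

/-- Convolution of finite signed measures on `ℝ`: the image of the product measure
under addition. -/
def measConv (μ ν : SignedMeasure ℝ) : SignedMeasure ℝ :=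
  (μ.prod ν (ContinuousLinearMap.mul ℝ ℝ)).map (fun p : ℝ × ℝ => p.1 + p.2)

/-- Convolution of matrices of signed measures (matrix product with respect to convolution). -/
def matConv {k l n : ℕ} (M : Matrix (Fin k) (Fin l) (SignedMeasure ℝ))
    (M' : Matrix (Fin l) (Fin n) (SignedMeasure ℝ)) :
    Matrix (Fin k) (Fin n) (SignedMeasure ℝ) :=
  Matrix.of fun i j => ∑ r, measConv (M i r) (M' r j)

/-- The matrix-valued measure `δ_a C`, where `C` is a real matrix. -/
def diracMatrix {k l : ℕ} (a : ℝ) (C : Matrix (Fin k) (Fin l) ℝ) :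
    Matrix (Fin k) (Fin l) (SignedMeasure ℝ) :=
  Matrix.of fun i j => VectorMeasure.dirac a (C i j)

/-- Convolution of a matrix of signed measures with a vector-valued function:
`(M * f)(t) = ∫ dM(s) f(t - s)`. -/
def funConv {k l : ℕ} (M : Matrix (Fin k) (Fin l) (SignedMeasure ℝ)) (f : ℝ → Fin l → ℝ) :
    ℝ → Fin k → ℝ :=
  fun t i => ∑ r, ∫ᵛ s, f (t - s) r ∂<•(M i r)

/-! ### Inputs -/

/-- The (essential) support of `u`: the complement of the largest open set on which
`u` vanishes almost everywhere. -/
def essSupport {k : ℕ} (u : ℝ → Fin k → ℝ) : Set ℝ :=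
  {t | ∀ U : Set ℝ, IsOpen U → t ∈ U → ¬ ∀ᵐ s, s ∈ U → u s = 0}

/-- The infimum of the support of `u`, which is `+∞` when `u` vanishes almost everywhere. -/
def startTime {k : ℕ} (u : ℝ → Fin k → ℝ) : EReal :=
  sInf ((fun t : ℝ => (t : EReal)) '' essSupport u)

/-- The input space `Ω₁`: integrable functions on `ℝ₋` (extended by zero to `ℝ`)
with compact support. -/
def IsInput {k : ℕ} (u : ℝ → Fin k → ℝ) : Prop :=
  Integrable u ∧ IsCompact (essSupport u) ∧ essSupport u ⊆ Set.Iic 0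

/-! ### Linear difference delay systems -/

/-- The data of `x(t) = ∑ⱼ Aⱼ x(t - Λⱼ) + B u(t)` with `N ≥ 1` delays `0 < Λ₁ < ⋯ < Λ_N`. -/
structure DelaySystem (d m N : ℕ) where
  A : Fin N → Matrix (Fin d) (Fin d) ℝ
  B : Matrix (Fin d) (Fin m) ℝ
  Λ : Fin N → ℝ
  N_pos : 0 < N
  Λ_pos : ∀ j, 0 < Λ j
  Λ_strictMono : StrictMono Λ

namespace DelaySystem

variable {d m N : ℕ} (sys : DelaySystem d m N)

/-- The largest delay `Λ_N`. -/
def ΛN : ℝ := sys.Λ ⟨N - 1, Nat.sub_lt sys.N_pos Nat.one_pos⟩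

/-- `Q = δ_{-Λ_N} I_d - ∑ⱼ δ_{-Λ_N + Λⱼ} Aⱼ`. -/
def Q : Matrix (Fin d) (Fin d) (SignedMeasure ℝ) :=
  diracMatrix (-sys.ΛN) 1 - ∑ j, diracMatrix (-sys.ΛN + sys.Λ j) (sys.A j)

/-- `P = δ₀ B`. -/
def P : Matrix (Fin d) (Fin m) (SignedMeasure ℝ) :=
  diracMatrix 0 sys.B

/-- `x` is the trajectory driven by the input `u`: it vanishes before the infimum of the
support of `u`, and satisfies the difference delay equation from then on. -/
def IsTrajectory (u : ℝ → Fin m → ℝ) (x : ℝ → Fin d → ℝ) : Prop :=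
  LocallyIntegrable x ∧
  (∀ᵐ t : ℝ, startTime u ≤ (t : EReal) →
    x t = ∑ j, sys.A j *ᵥ x (t - sys.Λ j) + sys.B *ᵥ u t) ∧
  (∀ᵐ t : ℝ, (t : EReal) < startTime u → x t = 0)

/-- `y` belongs to the state space `X^{Q,1}`: `y ∈ L¹_loc(ℝ₊, ℝ^d)` and the restriction of
`Q * y` to positive times vanishes, where `y` is extended by zero to negative times. Only the
values of `y` on `ℝ₊` matter. -/
def MemStateSpace (y : ℝ → Fin d → ℝ) : Prop :=
  LocallyIntegrableOn y (Set.Ici 0) ∧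
  ∀ᵐ t : ℝ, 0 < t → funConv sys.Q ((Set.Ici (0 : ℝ)).indicator y) t = 0

/-- `L¹` exact controllability: every `φ ∈ X^{Q,1}` is the output `y(t) = x(t - Λ_N)`, `t ≥ 0`,
associated with some input `u ∈ Ω₁`. -/
def L1ExactlyControllable : Prop :=
  ∀ φ : ℝ → Fin d → ℝ, sys.MemStateSpace φ →
    ∃ u : ℝ → Fin m → ℝ, IsInput u ∧ ∃ x : ℝ → Fin d → ℝ, sys.IsTrajectory u x ∧
      ∀ᵐ t : ℝ, 0 ≤ t → x (t - sys.ΛN) = φ t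

end DelaySystem

end DelayControl

end

open MeasureTheory Matrix

noncomputable section

namespace DelayControl

open Filter Topology Set
open scoped NNReal ENNReal BoundedContinuousFunction

/-! ### Integration against signed measures -/

/-! Sufficiency. Given `R` and `S`, extend a state `φ` by zero to `φ₀`. Then `ψ = Q * φ₀` lives on
`[-Λ_N, 0]`, and `r = R * ψ`, `u = S * ψ` are integrable and compactly supported in `ℝ₋`. The Bézout
identity (`ae_bezout_apply`) gives `Q * (φ₀ - r) = B u`, so `φ₀ - r`, shifted by `Λ_N`, is the
trajectory driven by `u`; since `r` vanishes for `t > 0`, its output is `φ`.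

Necessity. Controllability writes every integrable source `ψ` on `[-Λ_N, 0]` as `Q * r + B u`
(`exists_delayOp_add_eq`): solve forward with source `ψ`, then let `r` be the difference between the
resulting state and the output that reproduces it. Baire's theorem in `L¹` makes support and cost
uniform, up to small errors in the source (`exists_uniform_steers`). For sources tending to `δ₀ eᵢ`,
bounded mass on a fixed compact interval gives weak limits of `r` and `u`
(`exists_tendsto_signedMeasure`). These are the `i`-th columns of `R` and `S`, and the identity
passes to the limit against bounded continuous functions. -/

instance isFiniteMeasure_variation (μ : SignedMeasure ℝ) : IsFiniteMeasure μ.variation := by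
  rw [← μ.totalVariation_eq_variation]; infer_instance

/-- Product measures are determined by rectangles, where additivity is plain. Linearity on the left
suffices because `Q` and `P`, sums of Dirac masses, always stand there. -/
lemma measConv_add_left (μ μ' ν : SignedMeasure ℝ) :
    measConv (μ + μ') ν = measConv μ ν + measConv μ' ν := by
  have h : (μ + μ').prod ν (ContinuousLinearMap.mul ℝ ℝ) =
      μ.prod ν (ContinuousLinearMap.mul ℝ ℝ) + μ'.prod ν (ContinuousLinearMap.mul ℝ ℝ) :=
    VectorMeasure.prod_eq_of_forall_apply_prod fun s t _ _ => by simp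
  rw [measConv, h, VectorMeasure.map_add]; rfl

lemma measConv_zero_left (ν : SignedMeasure ℝ) : measConv 0 ν = 0 := by
  simpa using measConv_add_left 0 0 ν

lemma measConv_neg_left (μ ν : SignedMeasure ℝ) : measConv (-μ) ν = -measConv μ ν := by
  have := measConv_add_left (-μ) μ ν
  rw [neg_add_cancel, measConv_zero_left] at this
  exact eq_neg_of_add_eq_zero_left this.symm

lemma measConv_sub_left (μ μ' ν : SignedMeasure ℝ) :
    measConv (μ - μ') ν = measConv μ ν - measConv μ' ν := by
  rw [sub_eq_add_neg, measConv_add_left, measConv_neg_left, sub_eq_add_neg]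

lemma measConv_sum_left {ι : Type*} (s : Finset ι) (μ : ι → SignedMeasure ℝ)
    (ν : SignedMeasure ℝ) : measConv (∑ j ∈ s, μ j) ν = ∑ j ∈ s, measConv (μ j) ν := by
  classical
  induction s using Finset.induction_on with
  | empty => simpa using measConv_zero_left ν
  | insert a s ha ih => rw [Finset.sum_insert ha, Finset.sum_insert ha, measConv_add_left, ih]

/-- Convolution with `c δ_a` is `c` times translation by `a`. -/
lemma measConv_dirac (a c : ℝ) (ν : SignedMeasure ℝ) :
    measConv (VectorMeasure.dirac a c) ν = c • ν.map (fun s => s + a) := by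
  have h : (VectorMeasure.dirac a c : SignedMeasure ℝ).prod ν (ContinuousLinearMap.mul ℝ ℝ) =
      c • ν.map (fun s => (a, s)) := by
    apply VectorMeasure.prod_eq_of_forall_apply_prod
    intro s t hs ht
    rw [_root_.smul_apply, VectorMeasure.map_apply _ (by fun_prop) (hs.prod ht)]
    by_cases ha : a ∈ s
    · simp [VectorMeasure.dirac_apply_of_mem hs ha, Set.mk_preimage_prod_right ha]
    · simp [VectorMeasure.dirac_apply_of_notMem ha, Set.mk_preimage_prod_right_eq_empty ha]
  rw [measConv, h]
  ext s hs
  rw [VectorMeasure.map_apply _ (by fun_prop) hs, _root_.smul_apply,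
    _root_.smul_apply, VectorMeasure.map_apply _ (by fun_prop) hs,
    VectorMeasure.map_apply _ (by fun_prop)
      ((by fun_prop : Measurable fun p : ℝ × ℝ => p.1 + p.2) hs)]
  simp only [Set.preimage_preimage, add_comm]

lemma measurableEmbedding_add_const (a : ℝ) : MeasurableEmbedding fun s : ℝ => s + a :=
  (MeasurableEquiv.addRight a).measurableEmbedding

lemma integrable_measConv_dirac {a c : ℝ} {ν : SignedMeasure ℝ} {f : ℝ → ℝ}
    (hf : ν.Integrable fun s => f (s + a)) :
    (measConv (VectorMeasure.dirac a c) ν).Integrable f := by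
  rw [measConv_dirac]
  exact ((measurableEmbedding_add_const a).integrable_map_vectorMeasure.2 hf).smul_vectorMeasure c

lemma integral_measConv_dirac (a c : ℝ) (ν : SignedMeasure ℝ) (f : ℝ → ℝ) :
    ∫ᵛ s, f s ∂<•(measConv (VectorMeasure.dirac a c) ν) = c * ∫ᵛ s, f (s + a) ∂<•ν := by
  rw [measConv_dirac, VectorMeasure.integral_smul_vectorMeasure,
    (measurableEmbedding_add_const a).integral_map_vectorMeasure, smul_eq_mul]

/-- The integral against a signed measure, through its Jordan decomposition. -/
lemma integral_eq_posPart_sub_negPart (ν : SignedMeasure ℝ) {f : ℝ → ℝ} (hf : ν.Integrable f) :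
    ∫ᵛ s, f s ∂<•ν = ∫ s, f s ∂ν.toJordanDecomposition.posPart -
      ∫ s, f s ∂ν.toJordanDecomposition.negPart := by
  have hν := ν.toSignedMeasure_toJordanDecomposition
  have hf' : Integrable f ν.totalVariation := by rw [ν.totalVariation_eq_variation]; exact hf
  have h1 : ν.toJordanDecomposition.posPart.toSignedMeasure.Integrable f := by
    rw [VectorMeasure.Integrable, Measure.variation_toSignedMeasure]
    exact hf'.mono_measure (Measure.le_add_right le_rfl)
  have h2 : ν.toJordanDecomposition.negPart.toSignedMeasure.Integrable f := by
    rw [VectorMeasure.Integrable, Measure.variation_toSignedMeasure]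
    exact hf'.mono_measure (Measure.le_add_left le_rfl)
  conv_lhs => rw [← hν]
  rw [JordanDecomposition.toSignedMeasure, VectorMeasure.integral_sub_vectorMeasure h1 h2,
    VectorMeasure.integral_toSignedMeasure, VectorMeasure.integral_toSignedMeasure]

lemma integrable_boundedContinuous (ν : SignedMeasure ℝ) (f : BoundedContinuousFunction ℝ ℝ) :
    ν.Integrable f := f.integrable ν.variation

/-- Signed measures are determined by the integrals of bounded continuous functions. -/
lemma signedMeasure_ext {μ ν : SignedMeasure ℝ}
    (h : ∀ f : BoundedContinuousFunction ℝ ℝ, ∫ᵛ s, f s ∂<•μ = ∫ᵛ s, f s ∂<•ν) : μ = ν := by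
  rw [← sub_eq_zero]
  set σ := μ - ν with hσ
  -- Both Jordan parts of the difference are finite positive measures with equal integrals of
  -- bounded continuous functions, so they coincide and cancel.
  have h0 : σ.toJordanDecomposition.posPart = σ.toJordanDecomposition.negPart := by
    apply ext_of_forall_integral_eq_of_IsFiniteMeasure
    intro f
    have := integral_eq_posPart_sub_negPart σ (integrable_boundedContinuous σ f)
    rw [hσ, VectorMeasure.integral_sub_vectorMeasure (integrable_boundedContinuous _ f)
      (integrable_boundedContinuous _ f), h f, sub_self] at this
    linarith
  rw [← σ.toSignedMeasure_toJordanDecomposition, JordanDecomposition.toSignedMeasure]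
  simp [h0]

/-! ### Measures with compact support in `ℝ₋` -/

lemma memMNeg_of_variation_compl_Icc {μ : SignedMeasure ℝ} {T : ℝ}
    (h : μ.variation (Icc (-T) 0)ᶜ = 0) : MemMNeg μ := by
  have hs : μ.totalVariation.support ⊆ Icc (-T) 0 := by
    apply Measure.support_subset_of_isClosed isClosed_Icc
    rw [mem_ae_iff, μ.totalVariation_eq_variation]; exact h
  exact ⟨isCompact_Icc.of_isClosed_subset Measure.isClosed_support hs,
    hs.trans Icc_subset_Iic_self⟩

/-- Allowing every `T' ≥ T` lets all entries of several matrices share one interval. -/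
lemma MemMNeg.exists_variation_compl_Icc {μ : SignedMeasure ℝ} (h : MemMNeg μ) :
    ∃ T, 0 ≤ T ∧ ∀ T', T ≤ T' → ∀ᵐ s ∂μ.variation, s ∈ Icc (-T') 0 := by
  obtain ⟨hc, h0⟩ := h
  obtain ⟨b, hb⟩ := hc.bddBelow
  refine ⟨max 0 (-b), le_max_left _ _, fun T' hT' => ?_⟩
  rw [← μ.totalVariation_eq_variation]
  filter_upwards [Measure.support_mem_ae (μ := μ.totalVariation)] with s hs
  have := hb hs
  have := le_max_right 0 (-b)
  exact ⟨by linarith, h0 hs⟩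

/-! ### The Bézout operator -/

namespace DelaySystem

variable {d m N : ℕ} (sys : DelaySystem d m N)

lemma matConv_Q_apply {n : ℕ} (R : Matrix (Fin d) (Fin n) (SignedMeasure ℝ)) (i : Fin d)
    (k : Fin n) : matConv sys.Q R i k =
      ∑ r, (measConv (VectorMeasure.dirac (-sys.ΛN) ((1 : Matrix (Fin d) (Fin d) ℝ) i r)) (R r k) -
        ∑ j, measConv (VectorMeasure.dirac (-sys.ΛN + sys.Λ j) (sys.A j i r)) (R r k)) := by
  simp only [matConv, Q, diracMatrix, of_apply]
  refine Finset.sum_congr rfl fun r _ => ?_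
  rw [Matrix.sub_apply, Matrix.sum_apply, measConv_sub_left, measConv_sum_left]
  simp

/-- The integral of a function against `(Q * R + P * S)_{ik}`. -/
lemma integral_bezout {n : ℕ} (R : Matrix (Fin d) (Fin n) (SignedMeasure ℝ))
    (S : Matrix (Fin m) (Fin n) (SignedMeasure ℝ)) (i : Fin d) (k : Fin n) {f : ℝ → ℝ}
    (hf : ∀ r, (R r k).Integrable fun s => f (s - sys.ΛN))
    (hfj : ∀ r j, (R r k).Integrable fun s => f (s - sys.ΛN + sys.Λ j))
    (hfS : ∀ q, (S q k).Integrable f) :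
    ∫ᵛ s, f s ∂<•((matConv sys.Q R + matConv sys.P S) i k) =
      ∫ᵛ s, f (s - sys.ΛN) ∂<•(R i k) -
        ∑ j, ∑ r, sys.A j i r * ∫ᵛ s, f (s - sys.ΛN + sys.Λ j) ∂<•(R r k) +
      ∑ q, sys.B i q * ∫ᵛ s, f s ∂<•(S q k) := by
  have e1 : ∀ s, s + -sys.ΛN = s - sys.ΛN := fun s => by ring
  have e2 : ∀ s j, s + (-sys.ΛN + sys.Λ j) = s - sys.ΛN + sys.Λ j := fun s j => by ring
  -- `f` need not be bounded: it will also be `s ↦ ψ (t - s)` with `ψ` merely integrable, which is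
  -- integrable against the entries only for almost every `t`.
  have hR : ∀ r, (measConv (VectorMeasure.dirac (-sys.ΛN)
      ((1 : Matrix (Fin d) (Fin d) ℝ) i r)) (R r k)).Integrable f := fun r =>
    integrable_measConv_dirac (by simpa only [e1] using hf r)
  have hRj : ∀ r j, (measConv (VectorMeasure.dirac (-sys.ΛN + sys.Λ j) (sys.A j i r))
      (R r k)).Integrable f := fun r j =>
    integrable_measConv_dirac (by simpa only [e2] using hfj r j)
  have hS : ∀ q, (measConv (VectorMeasure.dirac 0 (sys.B i q)) (S q k)).Integrable f := fun q =>
    integrable_measConv_dirac (by simpa only [add_zero] using hfS q)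
  have hRs : ∀ r, (∑ j, measConv (VectorMeasure.dirac (-sys.ΛN + sys.Λ j) (sys.A j i r))
      (R r k)).Integrable f := fun r =>
    VectorMeasure.Integrable.finsetSum_vectorMeasure fun j _ => hRj r j
  have hP : matConv sys.P S i k = ∑ q, measConv (VectorMeasure.dirac 0 (sys.B i q)) (S q k) := rfl
  rw [Matrix.add_apply, matConv_Q_apply, hP, VectorMeasure.integral_add_vectorMeasure
      (VectorMeasure.Integrable.finsetSum_vectorMeasure fun r _ => (hR r).sub_vectorMeasure (hRs r))
      (VectorMeasure.Integrable.finsetSum_vectorMeasure fun q _ => hS q),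
    VectorMeasure.integral_finsetSum_vectorMeasure fun r _ => (hR r).sub_vectorMeasure (hRs r),
    VectorMeasure.integral_finsetSum_vectorMeasure fun q _ => hS q]
  congr 1
  · have : ∀ r, ∫ᵛ s, f s ∂<•(measConv (VectorMeasure.dirac (-sys.ΛN)
          ((1 : Matrix (Fin d) (Fin d) ℝ) i r)) (R r k) -
        ∑ j, measConv (VectorMeasure.dirac (-sys.ΛN + sys.Λ j) (sys.A j i r)) (R r k)) =
        (1 : Matrix (Fin d) (Fin d) ℝ) i r * ∫ᵛ s, f (s - sys.ΛN) ∂<•(R r k) -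
          ∑ j, sys.A j i r * ∫ᵛ s, f (s - sys.ΛN + sys.Λ j) ∂<•(R r k) := by
      intro r
      rw [VectorMeasure.integral_sub_vectorMeasure (hR r) (hRs r),
        VectorMeasure.integral_finsetSum_vectorMeasure fun j _ => hRj r j]
      simp only [integral_measConv_dirac, e1, e2]
    rw [Finset.sum_congr rfl fun r _ => this r, Finset.sum_sub_distrib, Finset.sum_comm]
    simp [Matrix.one_apply]
  · refine Finset.sum_congr rfl fun q _ => ?_
    simp only [integral_measConv_dirac, add_zero]

/-- The convolution operator `f ↦ Q * f`, in terms of translations. -/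
def delayOp (f : ℝ → Fin d → ℝ) (t : ℝ) : Fin d → ℝ :=
  f (t + sys.ΛN) - ∑ j, sys.A j *ᵥ f (t + sys.ΛN - sys.Λ j)

/-- Every function is integrable against a Dirac mass, so the equality holds at every `t`, with no
regularity of `f`. -/
lemma funConv_Q (f : ℝ → Fin d → ℝ) : funConv sys.Q f = sys.delayOp f := by
  ext t i
  have hd : ∀ (a c : ℝ) (r : Fin d),
      (VectorMeasure.dirac a c : SignedMeasure ℝ).Integrable fun s => f (t - s) r := by
    intro a c r
    rw [VectorMeasure.Integrable, VectorMeasure.variation_dirac]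
    exact (integrable_dirac (by simp)).smul_measure (by simp)
  have h : ∀ r, ∫ᵛ s, f (t - s) r ∂<•(sys.Q i r) =
      (1 : Matrix (Fin d) (Fin d) ℝ) i r * f (t + sys.ΛN) r -
        ∑ j, sys.A j i r * f (t + sys.ΛN - sys.Λ j) r := by
    intro r
    have hQ : sys.Q i r = VectorMeasure.dirac (-sys.ΛN) ((1 : Matrix (Fin d) (Fin d) ℝ) i r) -
        ∑ j, VectorMeasure.dirac (-sys.ΛN + sys.Λ j) (sys.A j i r) := by
      simp only [Q, diracMatrix]
      rw [Matrix.sub_apply, Matrix.sum_apply]; rfl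
    rw [hQ, VectorMeasure.integral_sub_vectorMeasure (hd _ _ r)
      (VectorMeasure.Integrable.finsetSum_vectorMeasure fun j _ => hd _ _ r),
      VectorMeasure.integral_finsetSum_vectorMeasure fun j _ => hd _ _ r]
    simp only [VectorMeasure.integral_dirac]
    congr 1
    · simp
    · refine Finset.sum_congr rfl fun j _ => ?_
      have : t - (-sys.ΛN + sys.Λ j) = t + sys.ΛN - sys.Λ j := by ring
      simp [this]
  rw [funConv, Finset.sum_congr rfl fun r _ => h r, Finset.sum_sub_distrib, Finset.sum_comm]
  simp [delayOp, Matrix.one_apply, mulVec, dotProduct]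

end DelaySystem

/-! ### Convolution of a signed measure with an integrable function -/

/-- This is the convolution integrand of `g` with the constant `1`, integrable because `τ` is
finite. -/
lemma integrable_comp_sub_prod (τ : Measure ℝ) [IsFiniteMeasure τ] {g : ℝ → ℝ}
    (hg : Integrable g) : Integrable (fun p : ℝ × ℝ => g (p.1 - p.2)) (volume.prod τ) := by
  simpa using Integrable.convolution_integrand (ContinuousLinearMap.mul ℝ ℝ)
    (integrable_const (1 : ℝ) : Integrable (fun _ : ℝ => (1 : ℝ)) τ) hg

lemma ae_integrable_comp_sub (ν : SignedMeasure ℝ) {g : ℝ → ℝ} (hg : Integrable g) :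
    ∀ᵐ t : ℝ, ν.Integrable fun s => g (t - s) :=
  (integrable_comp_sub_prod ν.variation hg).prod_right_ae

lemma integrable_integral_comp_sub (ν : SignedMeasure ℝ) {g : ℝ → ℝ} (hg : Integrable g) :
    Integrable fun t => ∫ᵛ s, g (t - s) ∂<•ν := by
  have h1 := (integrable_comp_sub_prod ν.toJordanDecomposition.posPart hg).integral_prod_left
  have h2 := (integrable_comp_sub_prod ν.toJordanDecomposition.negPart hg).integral_prod_left
  refine (h1.sub h2).congr ?_
  filter_upwards [ae_integrable_comp_sub ν hg] with t ht
  rw [integral_eq_posPart_sub_negPart ν ht]; rfl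

lemma integral_comp_sub_eq_zero {ν : SignedMeasure ℝ} {g : ℝ → ℝ} {T L t : ℝ}
    (hν : ∀ᵐ s ∂ν.variation, s ∈ Icc (-T) 0) (hg : ∀ s ∉ Icc (-L) 0, g s = 0)
    (ht : t ∉ Icc (-(T + L)) 0) : ∫ᵛ s, g (t - s) ∂<•ν = 0 := by
  apply VectorMeasure.integral_eq_zero_of_ae
  filter_upwards [hν] with s hs
  apply hg
  contrapose! ht
  exact ⟨by linarith [ht.1, hs.1], by linarith [ht.2, hs.2]⟩

/-- Convolution of a matrix of signed measures with a vector-valued function. -/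
def matFunConv {k l : ℕ} (M : Matrix (Fin k) (Fin l) (SignedMeasure ℝ)) (ψ : ℝ → Fin l → ℝ)
    (t : ℝ) : Fin k → ℝ :=
  fun i => ∑ r, ∫ᵛ s, ψ (t - s) r ∂<•(M i r)

lemma integrable_matFunConv {k l : ℕ} (M : Matrix (Fin k) (Fin l) (SignedMeasure ℝ))
    {ψ : ℝ → Fin l → ℝ} (hψ : ∀ r, Integrable fun t => ψ t r) : Integrable (matFunConv M ψ) :=
  Integrable.of_eval fun i => by
    unfold matFunConv
    exact integrable_finsetSum _ fun r _ =>
      integrable_integral_comp_sub (M i r) (g := fun t => ψ t r) (hψ r)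

lemma matFunConv_eq_zero {k l : ℕ} {M : Matrix (Fin k) (Fin l) (SignedMeasure ℝ)} {T L : ℝ}
    (hM : ∀ i r, ∀ᵐ s ∂(M i r).variation, s ∈ Icc (-T) 0) {ψ : ℝ → Fin l → ℝ}
    (hψ : ∀ s ∉ Icc (-L) 0, ψ s = 0) : ∀ t ∉ Icc (-(T + L)) 0, matFunConv M ψ t = 0 :=
  fun _ ht => funext fun i => Finset.sum_eq_zero fun r _ =>
    integral_comp_sub_eq_zero (g := fun t => ψ t r) (hM i r) (fun s hs => by simp [hψ s hs]) ht

lemma exists_variation_compl_Icc_matrix {k l : ℕ} {M : Matrix (Fin k) (Fin l) (SignedMeasure ℝ)}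
    (hM : ∀ i j, MemMNeg (M i j)) :
    ∃ T, 0 ≤ T ∧ ∀ T', T ≤ T' → ∀ i j, ∀ᵐ s ∂(M i j).variation, s ∈ Icc (-T') 0 := by
  choose T hT0 hT using fun i j => (hM i j).exists_variation_compl_Icc
  -- A sum of nonnegative bounds dominates each of them, and makes sense for empty index types too.
  refine ⟨∑ i, ∑ j, T i j, Finset.sum_nonneg fun i _ => Finset.sum_nonneg fun j _ => hT0 i j,
    fun T' hT' i j => hT i j _ (le_trans ?_ hT')⟩
  exact (Finset.single_le_sum (fun j _ => hT0 i j) (Finset.mem_univ j)).trans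
    (Finset.single_le_sum (f := fun i => ∑ j, T i j)
      (fun i _ => Finset.sum_nonneg fun j _ => hT0 i j) (Finset.mem_univ i))

lemma locallyIntegrable_indicator_Ici {E : Type*} [NormedAddCommGroup E] {φ : ℝ → E}
    (hφ : LocallyIntegrableOn φ (Ici 0)) : LocallyIntegrable ((Ici (0 : ℝ)).indicator φ) := by
  rw [← locallyIntegrableOn_univ]
  intro t _
  rw [nhdsWithin_univ]
  by_cases ht : 0 ≤ t
  · obtain ⟨U, hU, hi⟩ := hφ t ht
    obtain ⟨V, hV, hVU⟩ := mem_nhdsWithin_iff_exists_mem_nhds_inter.1 hU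
    exact ⟨V, hV, (integrable_indicator_iff measurableSet_Ici).2 (by
      rw [IntegrableOn, Measure.restrict_restrict measurableSet_Ici, inter_comm]
      exact hi.mono_set hVU)⟩
  · refine ⟨Iio 0, Iio_mem_nhds (not_le.1 ht), ?_⟩
    refine integrableOn_zero.congr_fun (fun s hs => ?_) measurableSet_Iio
    rw [indicator_of_notMem (by simpa using hs)]

/-! ### Essential support -/

section essSupport

variable {k : ℕ} {u : ℝ → Fin k → ℝ}

lemma isClosed_essSupport : IsClosed (essSupport u) := by
  rw [← isOpen_compl_iff, isOpen_iff_mem_nhds]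
  intro t ht
  simp only [essSupport, mem_compl_iff, mem_ofPred_eq, not_forall, not_not] at ht
  obtain ⟨U, hU, htU, h⟩ := ht
  filter_upwards [hU.mem_nhds htU] with s hs
  simp only [essSupport, mem_compl_iff, mem_ofPred_eq, not_forall, not_not]
  exact ⟨U, hU, hs, h⟩

/-- The complement of the support is a union of open sets where `u` vanishes almost everywhere;
second countability of `ℝ` makes the exceptional set null. -/
lemma ae_eq_zero_of_notMem_essSupport : ∀ᵐ t : ℝ, t ∉ essSupport u → u t = 0 := by
  rw [ae_iff]
  apply measure_null_of_locally_null
  intro t ht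
  simp only [essSupport, mem_ofPred_eq, not_forall, not_not] at ht
  obtain ⟨⟨U, hU, htU, h⟩, -⟩ := ht
  refine ⟨U ∩ {s | ¬ (s ∉ essSupport u → u s = 0)},
    inter_mem (mem_nhdsWithin_of_mem_nhds (hU.mem_nhds htU)) self_mem_nhdsWithin, measure_mono_null ?_ (ae_iff.1 h)⟩
  rintro s ⟨hs, hs'⟩
  simp only [mem_ofPred_eq, Classical.not_imp] at hs' ⊢
  exact ⟨hs, hs'.2⟩

lemma essSupport_subset {K : Set ℝ} (hK : IsClosed K) (h : ∀ᵐ t, t ∉ K → u t = 0) :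
    essSupport u ⊆ K := by
  intro t ht
  by_contra htK
  exact ht Kᶜ hK.isOpen_compl htK h

lemma notMem_essSupport_of_lt_startTime {t : ℝ} (ht : (t : EReal) < startTime u) :
    t ∉ essSupport u := fun h => (sInf_le (mem_image_of_mem _ h)).not_gt ht

lemma isInput_of_integrable {T : ℝ} (hu : Integrable u)
    (h : ∀ᵐ t, t ∉ Icc (-T) 0 → u t = 0) : IsInput u := by
  have := essSupport_subset isClosed_Icc h
  exact ⟨hu, isCompact_Icc.of_isClosed_subset isClosed_essSupport this,
    this.trans Icc_subset_Iic_self⟩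

lemma IsInput.exists_lower_bound (hu : IsInput u) :
    ∃ T : ℝ, 0 ≤ T ∧ (∀ t ∈ essSupport u, t ∈ Icc (-T) 0) ∧ ((-T : ℝ) : EReal) ≤ startTime u := by
  obtain ⟨b, hb⟩ := hu.2.1.bddBelow
  have h : ∀ t ∈ essSupport u, t ∈ Icc (-max 0 (-b)) 0 := fun t ht =>
    ⟨by linarith [hb ht, le_max_right 0 (-b)], hu.2.2 ht⟩
  refine ⟨max 0 (-b), le_max_left _ _, h, le_sInf ?_⟩
  rintro _ ⟨t, ht, rfl⟩
  exact EReal.coe_le_coe_iff.2 (h t ht).1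

end essSupport

/-! ### Translations and matrix multiples of functions -/

lemma ae_comp_sub {p : ℝ → Prop} (h : ∀ᵐ t, p t) (a : ℝ) : ∀ᵐ t : ℝ, p (t - a) :=
  (measurePreserving_sub_right volume a).quasiMeasurePreserving.ae h

lemma ae_comp_add {p : ℝ → Prop} (h : ∀ᵐ t, p t) (a : ℝ) : ∀ᵐ t : ℝ, p (t + a) :=
  (measurePreserving_add_right volume a).quasiMeasurePreserving.ae h

lemma locallyIntegrable_comp_add {E : Type*} [NormedAddCommGroup E] {f : ℝ → E}
    (hf : LocallyIntegrable f) (a : ℝ) : LocallyIntegrable fun t => f (t + a) := by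
  intro t
  obtain ⟨U, hU, h⟩ := hf (t + a)
  refine ⟨(fun s => s + a) ⁻¹' U, (by fun_prop : Continuous fun s : ℝ => s + a).continuousAt hU, ?_⟩
  exact ((measurePreserving_add_right volume a).integrableOn_comp_preimage
    (measurableEmbedding_add_const a)).2 h

lemma locallyIntegrable_mulVec {k l : ℕ} (A : Matrix (Fin k) (Fin l) ℝ) {f : ℝ → Fin l → ℝ}
    (hf : LocallyIntegrable f) : LocallyIntegrable fun t => A *ᵥ f t := fun t =>
  let ⟨U, hU, h⟩ := hf t
  ⟨U, hU, (LinearMap.toContinuousLinearMap A.mulVecLin).integrable_comp h⟩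

lemma integrable_mulVec {k l : ℕ} (A : Matrix (Fin k) (Fin l) ℝ) {f : ℝ → Fin l → ℝ}
    (hf : Integrable f) : Integrable fun t => A *ᵥ f t :=
  (LinearMap.toContinuousLinearMap A.mulVecLin).integrable_comp hf

/-! ### Forward propagation, sufficiency, and the uniform steering argument -/

namespace DelaySystem

variable {d m N : ℕ} (sys : DelaySystem d m N)

lemma exists_delay_lower_bound : ∃ δ, 0 < δ ∧ ∀ j, δ ≤ sys.Λ j :=
  ⟨sys.Λ ⟨0, sys.N_pos⟩, sys.Λ_pos _, fun j => sys.Λ_strictMono.monotone (by simp [Fin.le_def])⟩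

lemma ΛN_pos : 0 < sys.ΛN := sys.Λ_pos _

lemma locallyIntegrable_delayOp {f : ℝ → Fin d → ℝ} (hf : LocallyIntegrable f) :
    LocallyIntegrable (sys.delayOp f) := by
  refine (locallyIntegrable_comp_add hf _).sub ?_
  refine locallyIntegrable_finsetSum _ fun j _ => locallyIntegrable_mulVec _ ?_
  simpa only [add_sub_assoc] using locallyIntegrable_comp_add hf (sys.ΛN - sys.Λ j)

/-- The homogeneous equation propagates zero forward in time. -/
lemma ae_eq_zero_of_homogeneous {x : ℝ → Fin d → ℝ} {p : ℝ → Prop}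
    (hp : ∀ t s, s ≤ t → p t → p s) {M : ℝ} (h0 : ∀ᵐ t, t < M → x t = 0)
    (h : ∀ᵐ t, p t → x t = ∑ j, sys.A j *ᵥ x (t - sys.Λ j)) : ∀ᵐ t, p t → x t = 0 := by
  obtain ⟨δ, hδ, hΛ⟩ := sys.exists_delay_lower_bound
  -- Zero advances by the least delay `δ` at each step, all delayed times lying in the previous
  -- window.
  have key : ∀ k : ℕ, ∀ᵐ t, t < M + k * δ → p t → x t = 0 := by
    intro k
    induction k with
    | zero => filter_upwards [h0] with t ht h1 _; exact ht (by simpa using h1)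
    | succ k ih =>
      filter_upwards [h, ae_all_iff.2 fun j => ae_comp_sub ih (sys.Λ j)] with t ht hj h1 hpt
      rw [ht hpt]
      refine Finset.sum_eq_zero fun j _ => ?_
      have := hΛ j
      push_cast at h1
      rw [hj j (by linarith) (hp t _ (by linarith) hpt), mulVec_zero]
  filter_upwards [ae_all_iff.2 key] with t ht hpt
  obtain ⟨k, hk⟩ := exists_nat_gt ((t - M) / δ)
  rw [div_lt_iff₀ hδ] at hk
  exact ht k (by linarith) hpt

/-- The Bézout identity, applied to an integrable function. -/
lemma ae_bezout_apply {R : Matrix (Fin d) (Fin d) (SignedMeasure ℝ)}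
    {S : Matrix (Fin m) (Fin d) (SignedMeasure ℝ)}
    (h : matConv sys.Q R + matConv sys.P S = diracMatrix 0 (1 : Matrix (Fin d) (Fin d) ℝ))
    {ψ : ℝ → Fin d → ℝ} (hψik : ∀ k, Integrable fun t => ψ t k) :
    ∀ᵐ t, sys.delayOp (matFunConv R ψ) t + sys.B *ᵥ matFunConv S ψ t = ψ t := by
  filter_upwards [ae_all_iff.2 fun i => ae_all_iff.2 fun k =>
      ae_comp_add (ae_integrable_comp_sub (R i k) (hψik k)) sys.ΛN,
    ae_all_iff.2 fun i => ae_all_iff.2 fun k => ae_all_iff.2 fun j =>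
      ae_comp_add (ae_integrable_comp_sub (R i k) (hψik k)) (sys.ΛN - sys.Λ j),
    ae_all_iff.2 fun i => ae_all_iff.2 fun k => ae_integrable_comp_sub (S i k) (hψik k)]
    with t h1 h2 h3
  ext i
  have e1 : ∀ s, t - (s - sys.ΛN) = t + sys.ΛN - s := fun s => by ring
  have e2 : ∀ s j, t - (s - sys.ΛN + sys.Λ j) = t + (sys.ΛN - sys.Λ j) - s :=
    fun s j => by ring
  have hk : ∀ k, (1 : Matrix (Fin d) (Fin d) ℝ) i k * ψ t k =
      ∫ᵛ s, ψ (t + sys.ΛN - s) k ∂<•(R i k) -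
      ∑ j, ∑ l, sys.A j i l * ∫ᵛ s, ψ (t + (sys.ΛN - sys.Λ j) - s) k ∂<•(R l k) +
      ∑ q, sys.B i q * ∫ᵛ s, ψ (t - s) k ∂<•(S q k) := by
    intro k
    -- For almost every fixed `t`, the identity of measures is tested on `s ↦ ψ (t - s)`.
    have := sys.integral_bezout R S i k (f := fun s => ψ (t - s) k)
      (fun l => by simpa only [e1] using h1 l k) (fun l j => by simpa only [e2] using h2 l k j)
      (fun q => h3 q k)
    rw [h] at this
    simp only [diracMatrix, of_apply, VectorMeasure.integral_dirac, e1, e2] at this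
    rw [← this]
    simp [mul_comm]
  have hs : ψ t i = ∑ k, (1 : Matrix (Fin d) (Fin d) ℝ) i k * ψ t k := by
    simp [Matrix.one_apply]
  rw [hs, Finset.sum_congr rfl fun k _ => hk k, Finset.sum_add_distrib, Finset.sum_sub_distrib]
  simp only [delayOp, Pi.add_apply, Pi.sub_apply, Finset.sum_apply, mulVec, dotProduct, matFunConv,
    Finset.mul_sum, add_sub_assoc]
  refine congrArg₂ _ (congrArg₂ _ rfl ?_) Finset.sum_comm
  exact (Finset.sum_congr rfl fun j _ => Finset.sum_comm).trans Finset.sum_comm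

/-- A Bézout identity over `M(ℝ₋)` gives exact controllability. -/
theorem l1ExactlyControllable_of_bezout
    {R : Matrix (Fin d) (Fin d) (SignedMeasure ℝ)} {S : Matrix (Fin m) (Fin d) (SignedMeasure ℝ)}
    (hR : ∀ i j, MemMNeg (R i j)) (hS : ∀ i j, MemMNeg (S i j))
    (h : matConv sys.Q R + matConv sys.P S =
      diracMatrix 0 (1 : Matrix (Fin d) (Fin d) ℝ)) : sys.L1ExactlyControllable := by
  rintro φ ⟨hφ, hφQ⟩
  have hL := sys.ΛN_pos
  set φ₀ := (Ici (0 : ℝ)).indicator φ with hφ₀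
  have hφ₀i : LocallyIntegrable φ₀ := locallyIntegrable_indicator_Ici hφ
  rw [funConv_Q] at hφQ
  have hφneg : ∀ t, t < 0 → φ₀ t = 0 := fun t ht => indicator_of_notMem (by simpa using ht) _
  set ψ := (Icc (-sys.ΛN) 0).indicator (sys.delayOp φ₀) with hψ
  have hψi : Integrable ψ := (integrable_indicator_iff measurableSet_Icc).2
    ((sys.locallyIntegrable_delayOp hφ₀i).integrableOn_isCompact isCompact_Icc)
  have hψ0 : ∀ s ∉ Icc (-sys.ΛN) 0, ψ s = 0 := fun s hs => indicator_of_notMem hs _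
  -- The truncation loses nothing: `Q * φ₀` vanishes for `t > 0` by membership in the state space,
  -- and for `t < -Λ_N` because all its arguments are negative.
  have hψQ : ∀ᵐ t, ψ t = sys.delayOp φ₀ t := by
    filter_upwards [hφQ] with t ht
    by_cases h1 : t ∈ Icc (-sys.ΛN) 0
    · exact indicator_of_mem h1 _
    rw [hψ0 t h1]
    by_cases h2 : 0 < t
    · exact (ht h2).symm
    · have h3 : t + sys.ΛN < 0 := by
        by_contra h4; exact h1 ⟨by linarith, not_lt.1 h2⟩
      rw [delayOp, hφneg _ h3, Finset.sum_eq_zero, sub_zero]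
      intro j _
      rw [hφneg _ (by linarith [sys.Λ_pos j]), mulVec_zero]
  have hψik : ∀ k, Integrable fun t => ψ t k := fun k => hψi.eval k
  obtain ⟨TR, hTR0, hTR⟩ := exists_variation_compl_Icc_matrix hR
  obtain ⟨TS, -, hTS⟩ := exists_variation_compl_Icc_matrix hS
  set T := max TR TS
  have hT0 : 0 ≤ T := hTR0.trans (le_max_left _ _)
  replace hTR := fun i k => hTR T (le_max_left _ _) i k
  replace hTS := fun i k => hTS T (le_max_right _ _) i k
  have hri : Integrable (matFunConv R ψ) := integrable_matFunConv R hψik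
  have hui : Integrable (matFunConv S ψ) := integrable_matFunConv S hψik
  have hr0 := matFunConv_eq_zero hTR hψ0
  have hu0 := matFunConv_eq_zero hTS hψ0
  set r := matFunConv R ψ
  set u := matFunConv S ψ
  have hbez := sys.ae_bezout_apply h hψik
  have huI : IsInput u := isInput_of_integrable hui (ae_of_all _ hu0)
  have hEq : ∀ᵐ t, φ₀ (t + sys.ΛN) - r (t + sys.ΛN) = ∑ j, sys.A j *ᵥ
      (φ₀ (t - sys.Λ j + sys.ΛN) - r (t - sys.Λ j + sys.ΛN)) + sys.B *ᵥ u t := by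
    filter_upwards [hbez, hψQ] with t h1 h2
    rw [h2, delayOp, delayOp] at h1
    simp only [mulVec_sub, Finset.sum_sub_distrib, sub_add_eq_add_sub]
    rw [← sub_eq_zero] at h1 ⊢
    rw [← neg_eq_zero, ← h1]
    abel
  refine ⟨u, huI, fun t => φ₀ (t + sys.ΛN) - r (t + sys.ΛN), ⟨?_, ?_, ?_⟩, ?_⟩
  · exact locallyIntegrable_comp_add (hφ₀i.sub hri.locallyIntegrable) _
  · filter_upwards [hEq] with t ht _ using ht
  · refine sys.ae_eq_zero_of_homogeneous (M := -(T + sys.ΛN) - sys.ΛN)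
      (fun t s hst ht => (EReal.coe_le_coe_iff.2 hst).trans_lt ht) (ae_of_all _ fun t ht => ?_) ?_
    · rw [hφneg _ (by linarith), hr0 _ (fun h' => by linarith [h'.1]), sub_zero]
    · filter_upwards [hEq, ae_eq_zero_of_notMem_essSupport (u := u)] with t h1 h2 h3
      rw [h1, h2 (notMem_essSupport_of_lt_startTime h3), mulVec_zero, add_zero]
  · have h0 : ∀ᵐ t : ℝ, t ≠ 0 := by simp [ae_iff]
    filter_upwards [h0] with t ht0 ht
    rw [sub_add_cancel, hr0 t fun h' => ht0 (le_antisymm h'.2 ht), sub_zero]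
    exact indicator_of_mem ht _

/-! ### Solutions of the difference delay equation -/

/-- The iterates of the delay operator `f ↦ ∑ⱼ Aⱼ f(· - Λⱼ)` on `ψ`. -/
def delayIter (ψ : ℝ → Fin d → ℝ) : ℕ → ℝ → Fin d → ℝ
  | 0 => ψ
  | k + 1 => fun t => ∑ j, sys.A j *ᵥ delayIter ψ k (t - sys.Λ j)

lemma integrable_delayIter {ψ : ℝ → Fin d → ℝ} (hψ : Integrable ψ) (k : ℕ) :
    Integrable (sys.delayIter ψ k) := by
  induction k with
  | zero => exact hψ
  | succ k ih =>
    exact integrable_finsetSum _ fun j _ => integrable_mulVec _ (ih.comp_sub_right (sys.Λ j))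

lemma delayIter_eq_zero {ψ : ℝ → Fin d → ℝ} {M δ : ℝ} (hδ : ∀ j, δ ≤ sys.Λ j)
    (hψ : ∀ t, t < M → ψ t = 0) (k : ℕ) : ∀ t, t < M + k * δ → sys.delayIter ψ k t = 0 := by
  induction k with
  | zero => intro t ht; exact hψ t (by simpa using ht)
  | succ k ih =>
    intro t ht
    push_cast at ht
    refine Finset.sum_eq_zero fun j _ => ?_
    rw [ih (t - sys.Λ j) (by linarith [hδ j]), mulVec_zero]

/-- Existence of the solution with zero past of the equation with a source term. -/
lemma exists_solution {ψ : ℝ → Fin d → ℝ} (hψ : Integrable ψ) {M : ℝ}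
    (h0 : ∀ t, t < M → ψ t = 0) : ∃ x : ℝ → Fin d → ℝ, LocallyIntegrable x ∧
      (∀ t, t < M → x t = 0) ∧ ∀ t, x t = ∑ j, sys.A j *ᵥ x (t - sys.Λ j) + ψ t := by
  obtain ⟨δ, hδ, hΛ⟩ := sys.exists_delay_lower_bound
  -- The solution is the Neumann series of the delay operator. Its `k`-th term vanishes before `M +
  -- k δ`, so at `t` only finitely many terms count; the `+ 1` makes `t < M + K t * δ` strict.
  set K : ℝ → ℕ := fun t => ⌊(t - M) / δ⌋₊ + 1 with hK
  have hKt : ∀ t, t < M + K t * δ := fun t => by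
    have := Nat.lt_floor_add_one ((t - M) / δ)
    rw [div_lt_iff₀ hδ] at this
    simp only [hK]; push_cast; linarith
  have hz := sys.delayIter_eq_zero hΛ h0
  set x : ℝ → Fin d → ℝ := fun t => ∑ k ∈ Finset.range (K t), sys.delayIter ψ k t with hx
  have key : ∀ t (n : ℕ), t < M + n * δ → x t = ∑ k ∈ Finset.range n, sys.delayIter ψ k t := by
    have aux : ∀ t (a b : ℕ), a ≤ b → t < M + a * δ → ∑ k ∈ Finset.range b, sys.delayIter ψ k t =
        ∑ k ∈ Finset.range a, sys.delayIter ψ k t := by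
      intro t a b hab ha
      refine (Finset.sum_subset (Finset.range_subset_range.2 hab) fun k _ hk => hz k t ?_).symm
      have : (a : ℝ) ≤ k := by exact_mod_cast not_lt.1 (fun h => hk (Finset.mem_range.2 h))
      nlinarith
    intro t n hn
    rcases le_total n (K t) with h | h
    · exact aux t _ _ h hn
    · exact (aux t _ _ h (hKt t)).symm
  refine ⟨x, fun t => ?_, fun t ht => ?_, fun t => ?_⟩
  · refine ⟨Iio (M + K t * δ), Iio_mem_nhds (hKt t), ?_⟩
    have : Integrable fun s => ∑ k ∈ Finset.range (K t), sys.delayIter ψ k s :=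
      integrable_finsetSum _ fun k _ => sys.integrable_delayIter hψ k
    exact this.integrableOn.congr_fun (fun s hs => (key s _ hs).symm) measurableSet_Iio
  · simpa using key t 0 (by simpa using ht)
  · have h1 := hKt t
    rw [key t (K t + 1) (by push_cast; nlinarith), Finset.sum_range_succ']
    congr 1
    have h2 : ∀ j, x (t - sys.Λ j) = ∑ k ∈ Finset.range (K t), sys.delayIter ψ k (t - sys.Λ j) :=
      fun j => key _ _ (by linarith [hΛ j])
    simp only [h2, delayIter, mulVec_sum]
    exact Finset.sum_comm

/-- Under exact controllability, every source term on `[-Λ_N, 0]` is of the form `Q * r + P * u`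
with `r` and `u` integrable and compactly supported in `ℝ₋`. -/
lemma L1ExactlyControllable.exists_delayOp_add_eq {sys : DelaySystem d m N}
    (hc : sys.L1ExactlyControllable) {ψ : ℝ → Fin d → ℝ} (hψ : Integrable ψ)
    (h0 : ∀ s ∉ Icc (-sys.ΛN) 0, ψ s = 0) :
    ∃ (r : ℝ → Fin d → ℝ) (u : ℝ → Fin m → ℝ) (T : ℝ), Integrable r ∧ Integrable u ∧
      (∀ᵐ t, t ∉ Icc (-T) 0 → r t = 0) ∧ (∀ᵐ t, t ∉ Icc (-T) 0 → u t = 0) ∧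
      ∀ᵐ t, sys.delayOp r t + sys.B *ᵥ u t = ψ t := by
  have hL := sys.ΛN_pos
  obtain ⟨x, hxi, hx0, hx⟩ := sys.exists_solution hψ (M := -sys.ΛN)
    fun t ht => h0 t fun h => ht.not_ge h.1
  have hφi : LocallyIntegrable fun t => x (t - sys.ΛN) := by
    simpa only [sub_eq_add_neg] using locallyIntegrable_comp_add hxi (-sys.ΛN)
  have hφ0 : ∀ t, t < 0 → x (t - sys.ΛN) = 0 := fun t ht => hx0 _ (by linarith)
  have hind : (Ici (0 : ℝ)).indicator (fun t => x (t - sys.ΛN)) = fun t => x (t - sys.ΛN) :=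
    indicator_eq_self.2 fun t ht => not_lt.1 fun h => ht (hφ0 t h)
  have hQ : ∀ t, sys.delayOp (fun t => x (t - sys.ΛN)) t = ψ t := by
    intro t
    have e : ∀ j, t + sys.ΛN - sys.Λ j - sys.ΛN = t - sys.Λ j := fun j => by ring
    simp only [delayOp, add_sub_cancel_right, e]
    conv_lhs => rw [hx t]
    abel
  obtain ⟨u, hu, x', ⟨hx'i, hx'eq, hx'0⟩, hout⟩ := hc (fun t => x (t - sys.ΛN))
    ⟨hφi.locallyIntegrableOn _, by
      rw [hind, funConv_Q]
      exact ae_of_all _ fun t ht => by rw [hQ, h0 t fun h => ht.not_ge h.2]⟩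
  obtain ⟨T, hT0, huT, hsT⟩ := hu.exists_lower_bound
  have hu0 := ae_eq_zero_of_notMem_essSupport (u := u)
  -- Before the start of `u` both sides vanish, so the equation holds at almost all times.
  have hx'Q : ∀ᵐ t, x' t = ∑ j, sys.A j *ᵥ x' (t - sys.Λ j) + sys.B *ᵥ u t := by
    filter_upwards [hx'eq, hx'0, ae_all_iff.2 fun j => ae_comp_sub hx'0 (sys.Λ j), hu0]
      with t h1 h2 h3 h4
    rcases le_or_gt (startTime u) (t : EReal) with h | h
    · exact h1 h
    · rw [h2 h, h4 (notMem_essSupport_of_lt_startTime h), mulVec_zero, add_zero,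
        Finset.sum_eq_zero]
      intro j _
      rw [h3 j ((EReal.coe_le_coe_iff.2 (by linarith [sys.Λ_pos j])).trans_lt h), mulVec_zero]
  set r : ℝ → Fin d → ℝ := fun t => x (t - sys.ΛN) - x' (t - sys.ΛN) with hr
  -- For `t ≥ 0` the two outputs agree; for `t < -T` both terms vanish.
  have hr0 : ∀ᵐ t, t ∉ Icc (-T) 0 → r t = 0 := by
    filter_upwards [hout, ae_comp_sub hx'0 sys.ΛN] with t h1 h2 ht
    rcases le_or_gt 0 t with h | h
    · simp [hr, h1 h]
    · have ht' : t < -T := by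
        by_contra h'; exact ht ⟨not_lt.1 h', h.le⟩
      have : ((t - sys.ΛN : ℝ) : EReal) < startTime u :=
        (EReal.coe_lt_coe_iff.2 (by linarith)).trans_le hsT
      simp [hr, h2 this, hφ0 t h]
  refine ⟨r, u, T, ?_, hu.1, hr0, ?_, ?_⟩
  · have hri : LocallyIntegrable r := hφi.sub (by
      simpa only [sub_eq_add_neg] using locallyIntegrable_comp_add hx'i (-sys.ΛN))
    refine ((integrable_indicator_iff measurableSet_Icc).2
      (hri.integrableOn_isCompact (isCompact_Icc (a := -T) (b := 0)))).congr ?_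
    filter_upwards [hr0] with t ht
    by_cases h : t ∈ Icc (-T) 0
    · rw [indicator_of_mem h]
    · rw [indicator_of_notMem h, ht h]
  · filter_upwards [hu0] with t h1 h2 using h1 fun h => h2 (huT t h)
  · filter_upwards [hx'Q] with t ht
    have e : ∀ j, t + sys.ΛN - sys.Λ j - sys.ΛN = t - sys.Λ j := fun j => by ring
    have h1 := hQ t
    simp only [delayOp, add_sub_cancel_right, e] at h1
    simp only [delayOp, hr, add_sub_cancel_right, e, mulVec_sub, Finset.sum_sub_distrib]
    rw [← h1]
    conv_lhs => rw [ht]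
    abel

/-! ### Uniform control time and cost, by Baire's theorem -/

/-- The pair `(r, u)` is supported in `[-T, 0]`, its components have `L¹` norm at most `C`,
and `Q * r + P * u` is the source term `ρ eᵢ` on `[-Λ_N, 0]`. -/
structure Steers (i : Fin d) (T C : ℝ) (r : ℝ → Fin d → ℝ) (u : ℝ → Fin m → ℝ) (ρ : ℝ → ℝ) :
    Prop where
  integrable_left : Integrable r
  integrable_right : Integrable u
  support_left : ∀ᵐ t, t ∉ Icc (-T) 0 → r t = 0
  support_right : ∀ᵐ t, t ∉ Icc (-T) 0 → u t = 0
  norm_left : ∀ j, ∫ t, ‖r t j‖ ≤ C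
  norm_right : ∀ j, ∫ t, ‖u t j‖ ≤ C
  eq : ∀ᵐ t, sys.delayOp r t + sys.B *ᵥ u t =
    Pi.single i ((Icc (-sys.ΛN) 0).indicator ρ t)

lemma delayOp_sub (f g : ℝ → Fin d → ℝ) (t : ℝ) :
    sys.delayOp (f - g) t = sys.delayOp f t - sys.delayOp g t := by
  simp only [delayOp, Pi.sub_apply, mulVec_sub, Finset.sum_sub_distrib]
  abel

lemma delayOp_smul (c : ℝ) (f : ℝ → Fin d → ℝ) (t : ℝ) :
    sys.delayOp (c • f) t = c • sys.delayOp f t := by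
  simp only [delayOp, Pi.smul_apply, mulVec_smul, smul_sub, Finset.smul_sum]

variable {sys}

lemma integral_norm_smul_sub_le {k : ℕ} {f g : ℝ → Fin k → ℝ} (hf : Integrable f)
    (hg : Integrable g) {C c : ℝ} (hc : 0 ≤ c) (j : Fin k) (hfC : ∫ t, ‖f t j‖ ≤ C)
    (hgC : ∫ t, ‖g t j‖ ≤ C) : ∫ t, ‖(c • (f - g)) t j‖ ≤ c * (2 * C) := by
  have hf' := (hf.eval j).norm
  have hg' := (hg.eval j).norm
  calc ∫ t, ‖(c • (f - g)) t j‖ ≤ ∫ t, c * (‖f t j‖ + ‖g t j‖) := by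
        refine integral_mono_of_nonneg (ae_of_all _ fun t => norm_nonneg _)
          ((hf'.add hg').const_mul c) (ae_of_all _ fun t => ?_)
        simp only [Pi.smul_apply, Pi.sub_apply, smul_eq_mul, norm_mul, Real.norm_of_nonneg hc]
        exact mul_le_mul_of_nonneg_left (norm_sub_le _ _) hc
    _ = c * ((∫ t, ‖f t j‖) + ∫ t, ‖g t j‖) := by
        rw [integral_const_mul, integral_add hf' hg']
    _ ≤ c * (2 * C) := mul_le_mul_of_nonneg_left (by linarith) hc

/-- Differences recentre the ball found by Baire's theorem and scaling normalises it; the cost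
changes, the support interval does not. -/
lemma Steers.smul_sub {i : Fin d} {T C c : ℝ} (hc : 0 ≤ c) {r r' : ℝ → Fin d → ℝ}
    {u u' : ℝ → Fin m → ℝ} {ρ ρ' : ℝ → ℝ} (h : sys.Steers i T C r u ρ)
    (h' : sys.Steers i T C r' u' ρ') :
    sys.Steers i T (c * (2 * C)) (c • (r - r')) (c • (u - u')) (c • (ρ - ρ')) where
  integrable_left := (h.1.sub h'.1).smul c
  integrable_right := (h.2.sub h'.2).smul c
  support_left := by
    filter_upwards [h.3, h'.3] with t h1 h2 ht
    simp [h1 ht, h2 ht]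
  support_right := by
    filter_upwards [h.4, h'.4] with t h1 h2 ht
    simp [h1 ht, h2 ht]
  norm_left j := integral_norm_smul_sub_le h.1 h'.1 hc j (h.5 j) (h'.5 j)
  norm_right j := integral_norm_smul_sub_le h.2 h'.2 hc j (h.6 j) (h'.6 j)
  eq := by
    filter_upwards [h.7, h'.7] with t h1 h2
    have e : sys.delayOp (c • (r - r')) t + sys.B *ᵥ (c • (u - u')) t =
        c • ((sys.delayOp r t + sys.B *ᵥ u t) - (sys.delayOp r' t + sys.B *ᵥ u' t)) := by
      rw [delayOp_smul, delayOp_sub, Pi.smul_apply, Pi.sub_apply, mulVec_smul, mulVec_sub,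
        ← smul_add]
      congr 1; abel
    rw [e, h1, h2, ← Pi.single_sub, ← Pi.single_smul]
    by_cases ht : t ∈ Icc (-sys.ΛN) 0
    · simp [indicator_of_mem ht]
    · simp [indicator_of_notMem ht]

lemma Steers.congr {i : Fin d} {T C : ℝ} {r : ℝ → Fin d → ℝ} {u : ℝ → Fin m → ℝ} {ρ ρ' : ℝ → ℝ}
    (h : sys.Steers i T C r u ρ) (hρ : ρ =ᵐ[volume.restrict (Icc (-sys.ΛN) 0)] ρ') :
    sys.Steers i T C r u ρ' :=
  { h with
    eq := by
      filter_upwards [h.7, (ae_restrict_iff' measurableSet_Icc).1 hρ] with t h1 h2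
      rw [h1]
      by_cases ht : t ∈ Icc (-sys.ΛN) 0
      · rw [indicator_of_mem ht, indicator_of_mem ht, h2 ht]
      · rw [indicator_of_notMem ht, indicator_of_notMem ht] }

lemma L1ExactlyControllable.exists_steers (hc : sys.L1ExactlyControllable) (i : Fin d)
    {ρ : ℝ → ℝ} (hρ : IntegrableOn ρ (Icc (-sys.ΛN) 0)) :
    ∃ (n : ℕ) (r : ℝ → Fin d → ℝ) (u : ℝ → Fin m → ℝ), sys.Steers i n n r u ρ := by
  have hρ' := (integrable_indicator_iff measurableSet_Icc).2 hρ
  obtain ⟨r, u, T, hr, hu, hr0, hu0, h⟩ := hc.exists_delayOp_add_eq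
    (ψ := fun t => Pi.single i ((Icc (-sys.ΛN) 0).indicator ρ t))
    (Integrable.of_eval fun l => by
      by_cases hl : l = i
      · subst hl; simpa using hρ'
      · simp [hl]) (fun s hs => by rw [indicator_of_notMem hs, Pi.single_zero])
  -- One integer bounds both support and cost, so countably many classes cover all sources.
  obtain ⟨n, hn⟩ := exists_nat_ge (max T ((∑ j, ∫ t, ‖r t j‖) + ∑ j, ∫ t, ‖u t j‖))
  have hR : 0 ≤ ∑ j, ∫ t, ‖r t j‖ :=
    Finset.sum_nonneg fun j _ => integral_nonneg fun t => norm_nonneg _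
  have hU : 0 ≤ ∑ j, ∫ t, ‖u t j‖ :=
    Finset.sum_nonneg fun j _ => integral_nonneg fun t => norm_nonneg _
  have hn1 := (le_max_left _ _).trans hn
  have hn2 := (le_max_right _ _).trans hn
  have hsub : Icc (-T) 0 ⊆ Icc (-(n : ℝ)) 0 := Icc_subset_Icc_left (by linarith)
  refine ⟨n, r, u, hr, hu, ?_, ?_, fun j => ?_, fun j => ?_, h⟩
  · filter_upwards [hr0] with t h1 h2 using h1 fun h => h2 (hsub h)
  · filter_upwards [hu0] with t h1 h2 using h1 fun h => h2 (hsub h)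
  · have := Finset.single_le_sum (f := fun j => ∫ t, ‖r t j‖)
      (fun j _ => integral_nonneg fun t => norm_nonneg _) (Finset.mem_univ j)
    linarith
  · have := Finset.single_le_sum (f := fun j => ∫ t, ‖u t j‖)
      (fun j _ => integral_nonneg fun t => norm_nonneg _) (Finset.mem_univ j)
    linarith

/-- Uniform approximate steering. -/
lemma L1ExactlyControllable.exists_uniform_steers (hc : sys.L1ExactlyControllable) (i : Fin d) :
    ∃ T C : ℝ, ∀ ρ : Lp ℝ 1 (volume.restrict (Icc (-sys.ΛN) 0)), ‖ρ‖ ≤ 1 → ∀ η > 0,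
      ∃ (ρ' : Lp ℝ 1 (volume.restrict (Icc (-sys.ΛN) 0))) (r : ℝ → Fin d → ℝ)
        (u : ℝ → Fin m → ℝ), ‖ρ' - ρ‖ ≤ η ∧ sys.Steers i T C r u ρ' := by
  set G : ℕ → Set (Lp ℝ 1 (volume.restrict (Icc (-sys.ΛN) 0))) := fun n =>
    {ρ | ∃ (r : ℝ → Fin d → ℝ) (u : ℝ → Fin m → ℝ), sys.Steers i n n r u ρ} with hG
  -- Taking closures avoids proving `G n` closed; the price is that steering is only approximate.
  obtain ⟨n, ρ₀, hρ₀⟩ := nonempty_interior_of_iUnion_of_closed (f := fun n => closure (G n))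
    (fun n => isClosed_closure) (eq_univ_of_forall fun ρ => by
      obtain ⟨n, h⟩ := hc.exists_steers i (L1.integrable_coeFn ρ)
      exact mem_iUnion.2 ⟨n, subset_closure h⟩)
  obtain ⟨ε, hε, hball⟩ := Metric.isOpen_iff.1 isOpen_interior ρ₀ hρ₀
  replace hball := hball.trans interior_subset
  -- Write `ρ = (2/ε) ((ρ₀ + (ε/2) ρ) - ρ₀)`: both points lie in the ball and are approximated by
  -- sources of cost `n`. Two errors `η ε / 4`, scaled by `2/ε`, add up to `η`.
  refine ⟨n, 2 / ε * (2 * n), fun ρ hρ η hη => ?_⟩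
  have h1 : ρ₀ + (ε / 2) • ρ ∈ closure (G n) := hball (by
    rw [mem_ball_iff_norm, add_sub_cancel_left, norm_smul, Real.norm_of_nonneg (by positivity)]
    nlinarith)
  have hη' : 0 < η * ε / 4 := by positivity
  obtain ⟨a, ⟨r, u, ha⟩, ha'⟩ := Metric.mem_closure_iff.1 h1 _ hη'
  obtain ⟨b, ⟨r', u', hb⟩, hb'⟩ := Metric.mem_closure_iff.1
    (hball (Metric.mem_ball_self hε)) _ hη'
  refine ⟨(2 / ε) • (a - b), _, _, ?_, (ha.smul_sub (by positivity : 0 ≤ 2 / ε) hb).congr ?_⟩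
  · rw [dist_eq_norm] at ha' hb'
    have e : (2 / ε) • (a - b) - ρ = (2 / ε) • ((ρ₀ - b) - (ρ₀ + (ε / 2) • ρ - a)) := by
      have : ρ = (2 / ε) • (ε / 2) • ρ := by
        rw [smul_smul, show 2 / ε * (ε / 2) = 1 by field_simp, one_smul]
      conv_lhs => rw [this]
      rw [← smul_sub]
      congr 1; abel
    rw [e, norm_smul, Real.norm_of_nonneg (by positivity)]
    calc 2 / ε * ‖(ρ₀ - b) - (ρ₀ + (ε / 2) • ρ - a)‖
        ≤ 2 / ε * (η * ε / 4 + η * ε / 4) := by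
          refine mul_le_mul_of_nonneg_left ((norm_sub_le _ _).trans ?_) (by positivity)
          linarith
      _ = η := by field_simp; norm_num
  · filter_upwards [Lp.coeFn_smul (2 / ε) (a - b), Lp.coeFn_sub a b] with t h1 h2
    rw [h1, Pi.smul_apply, Pi.smul_apply, h2]

end DelaySystem

/-! ### Weak limits of integrable functions -/

/-- Nonnegative functions, bounded in `L¹` and supported in `[-T, 0]`, converge weakly to a finite
measure along any ultrafilter. -/
lemma exists_tendsto_measure (l : Ultrafilter ℕ) {T C : ℝ} {g : ℕ → ℝ → ℝ}
    (hg : ∀ k, Integrable (g k)) (h0 : ∀ k t, 0 ≤ g k t)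
    (hs : ∀ k, ∀ᵐ t, t ∉ Icc (-T) 0 → g k t = 0) (hC : ∀ k, ∫ t, g k t ≤ C) :
    ∃ μ : FiniteMeasure ℝ, μ (Icc (-T) 0)ᶜ = 0 ∧ ∀ f : ℝ →ᵇ ℝ,
      Tendsto (fun k => ∫ t, f t * g k t) l (𝓝 (∫ t, f t ∂μ)) := by
  have hC0 : 0 ≤ C := (integral_nonneg (h0 0)).trans (hC 0)
  let ν : ℕ → FiniteMeasure ℝ := fun k =>
    ⟨volume.withDensity fun t => ENNReal.ofReal (g k t),
      isFiniteMeasure_withDensity_ofReal (hg k).2⟩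
  have hνi : ∀ k (f : ℝ →ᵇ ℝ), ∫ t, f t ∂(ν k : Measure ℝ) = ∫ t, f t * g k t := by
    intro k f
    change ∫ t, f t ∂(volume.withDensity fun t => ENNReal.ofReal (g k t)) = _
    rw [integral_withDensity_eq_integral_toReal_smul₀ (hg k).aemeasurable.ennreal_ofReal
      (ae_of_all _ fun t => ENNReal.ofReal_lt_top)]
    refine integral_congr_ae (ae_of_all _ fun t => ?_)
    simp only [ENNReal.toReal_ofReal (h0 k t), smul_eq_mul, mul_comm]
  have hνC : ∀ k, (ν k).mass ≤ C.toNNReal ∧ ν k (Icc (-T) 0)ᶜ = 0 := by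
    intro k
    constructor
    · rw [← ENNReal.coe_le_coe, FiniteMeasure.ennreal_mass]
      change (volume.withDensity fun t => ENNReal.ofReal (g k t)) univ ≤ ENNReal.ofReal C
      rw [withDensity_apply _ MeasurableSet.univ, Measure.restrict_univ,
        ← ofReal_integral_eq_lintegral_ofReal (hg k) (ae_of_all _ (h0 k))]
      exact ENNReal.ofReal_le_ofReal (hC k)
    · rw [FiniteMeasure.null_iff_toMeasure_null]
      change (volume.withDensity fun t => ENNReal.ofReal (g k t)) _ = 0
      rw [withDensity_apply _ measurableSet_Icc.compl,
        lintegral_eq_zero_iff' (hg k).aemeasurable.ennreal_ofReal.restrict]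
      filter_upwards [ae_restrict_of_ae (hs k), ae_restrict_mem measurableSet_Icc.compl]
        with t h1 h2
      simp [h1 h2]
  -- Measures of bounded mass carried by a fixed compact interval form a weakly compact set, where
  -- every ultrafilter converges.
  obtain ⟨μ, ⟨-, hμ⟩, hlim⟩ :=
    (isCompact_setOfPred_finiteMeasure_le_of_isCompact (E := ℝ) C.toNNReal
      (isCompact_Icc (a := -T) (b := 0))).ultrafilter_le_nhds' (l.map ν)
      (Ultrafilter.mem_map.2 (univ_mem' hνC))
  refine ⟨μ, hμ, fun f => ?_⟩
  have : Tendsto ν l (𝓝 μ) := hlim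
  simpa only [hνi] using FiniteMeasure.tendsto_iff_forall_integral_tendsto.1 this f

/-- Functions bounded in `L¹` and supported in `[-T, 0]` converge weakly to a signed measure
in `M(ℝ₋)` along any ultrafilter. -/
lemma exists_tendsto_signedMeasure (l : Ultrafilter ℕ) {T C : ℝ} {g : ℕ → ℝ → ℝ}
    (hg : ∀ k, Integrable (g k)) (hs : ∀ k, ∀ᵐ t, t ∉ Icc (-T) 0 → g k t = 0)
    (hC : ∀ k, ∫ t, ‖g k t‖ ≤ C) :
    ∃ μ : SignedMeasure ℝ, MemMNeg μ ∧ ∀ f : ℝ →ᵇ ℝ,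
      Tendsto (fun k => ∫ t, f t * g k t) l (𝓝 (∫ᵛ t, f t ∂<•μ)) := by
  obtain ⟨μ, hμ, hμt⟩ := exists_tendsto_measure l (T := T) (C := C)
    (g := fun k t => max (g k t) 0)
    (fun k => (hg k).pos_part) (fun k t => le_max_right _ _)
    (fun k => (hs k).mono fun t h ht => by simp [h ht])
    (fun k => (integral_mono (hg k).pos_part (hg k).norm fun t =>
      max_le (le_abs_self _) (abs_nonneg _)).trans (hC k))
  obtain ⟨ν, hν, hνt⟩ := exists_tendsto_measure l (T := T) (C := C)
    (g := fun k t => max (-g k t) 0)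
    (fun k => (hg k).neg_part) (fun k t => le_max_right _ _)
    (fun k => (hs k).mono fun t h ht => by simp [h ht])
    (fun k => (integral_mono (hg k).neg_part (hg k).norm fun t =>
      max_le (neg_le_abs _) (abs_nonneg _)).trans (hC k))
  -- The limits of the positive and negative parts need not be mutually singular; the bound of the
  -- variation by `μ + ν` still controls the support.
  refine ⟨(μ : Measure ℝ).toSignedMeasure - (ν : Measure ℝ).toSignedMeasure, ?_, fun f => ?_⟩
  · apply memMNeg_of_variation_compl_Icc (T := T)
    have h1 := VectorMeasure.variation_sub_le (μ := (μ : Measure ℝ).toSignedMeasure)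
      (ν := (ν : Measure ℝ).toSignedMeasure) (Icc (-T) 0)ᶜ
    rw [FiniteMeasure.null_iff_toMeasure_null] at hμ hν
    rw [Measure.variation_toSignedMeasure, Measure.variation_toSignedMeasure, Measure.add_apply,
      hμ, hν, add_zero] at h1
    exact le_zero_iff.1 h1
  · rw [VectorMeasure.integral_sub_vectorMeasure (integrable_boundedContinuous _ f)
      (integrable_boundedContinuous _ f), VectorMeasure.integral_toSignedMeasure,
      VectorMeasure.integral_toSignedMeasure]
    refine ((hμt f).sub (hνt f)).congr fun k => ?_
    have hbd : ∀ {h : ℝ → ℝ}, Integrable h → Integrable fun t => f t * h t := fun hh =>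
      hh.bdd_mul f.continuous.aestronglyMeasurable (ae_of_all _ f.norm_coe_le_norm)
    rw [← integral_sub (hbd (hg k).pos_part) (hbd (hg k).neg_part)]
    refine integral_congr_ae (ae_of_all _ fun t => ?_)
    simp only [← mul_sub]
    congr 1
    rcases le_total 0 (g k t) with h | h
    · simp [h]
    · simp [h]

/-! ### Approximation of the Dirac mass -/

/-- There are norm one elements of `L¹(-L, 0)` converging weakly to the Dirac mass at `0`. -/
lemma exists_approx_dirac {L : ℝ} (hL : 0 < L) :
    ∃ ρ : ℕ → Lp ℝ 1 (volume.restrict (Icc (-L) 0)), (∀ k, ‖ρ k‖ ≤ 1) ∧ ∀ f : ℝ →ᵇ ℝ,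
      Tendsto (fun k => ∫ t in Icc (-L) 0, f t * ρ k t) atTop (𝓝 (f 0)) := by
  set h : ℕ → ℝ := fun k => L / (k + 1) with hh
  have hpos : ∀ k, 0 < h k := fun k => by positivity
  have hle : ∀ k, h k ≤ L := fun k => div_le_self hL.le (by linarith [(k.cast_nonneg : (0:ℝ) ≤ k)])
  have hlim : Tendsto h atTop (𝓝 0) := by
    refine ((tendsto_const_div_atTop_nhds_zero_nat L).comp (tendsto_add_atTop_nat 1)).congr
      fun k => ?_
    simp [hh]
  set g : ℕ → ℝ → ℝ := fun k => (Ioc (-h k) 0).indicator fun _ => (h k)⁻¹ with hg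
  have hsub : ∀ k, Ioc (-h k) 0 ⊆ Icc (-L) 0 := fun k t ht =>
    ⟨by linarith [ht.1, hle k], ht.2⟩
  have hgi : ∀ k, Integrable (g k) (volume.restrict (Icc (-L) 0)) := fun k =>
    (integrable_const _).indicator measurableSet_Ioc
  have hint : ∀ k (f : ℝ → ℝ), ∫ t in Icc (-L) 0, f t * g k t =
      (h k)⁻¹ * ∫ t in (-h k)..0, f t := by
    intro k f
    have e : (fun t => f t * g k t) = (Ioc (-h k) 0).indicator fun t => f t * (h k)⁻¹ := by
      ext t
      by_cases ht : t ∈ Ioc (-h k) 0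
      · simp only [hg, indicator_of_mem ht]
      · simp only [hg, indicator_of_notMem ht, mul_zero]
    rw [e, integral_indicator measurableSet_Ioc, Measure.restrict_restrict measurableSet_Ioc,
      inter_eq_left.2 (hsub k), integral_mul_const,
      intervalIntegral.integral_of_le (by linarith [hpos k]), mul_comm]
  refine ⟨fun k => (hgi k).toL1 (g k), fun k => ?_, fun f => ?_⟩
  · rw [L1.norm_of_fun_eq_integral_norm]
    have e : ∀ t, ‖g k t‖ = 1 * g k t := fun t => by
      rw [one_mul, Real.norm_of_nonneg]
      exact indicator_nonneg (fun _ _ => (inv_pos.2 (hpos k)).le) _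
    simp only [e]
    rw [hint k fun _ => 1, intervalIntegral.integral_const]
    simp [(hpos k).ne']
  · have hd : HasDerivAt (fun x => ∫ t in (0 : ℝ)..x, f t) (f 0) 0 :=
      (f.continuous.integral_hasStrictDerivAt 0 0).hasDerivAt
    have ht : Tendsto (fun k => -h k) atTop (𝓝[≠] 0) :=
      tendsto_nhdsWithin_iff.2 ⟨by simpa using hlim.neg,
        Eventually.of_forall fun k => (neg_neg_of_pos (hpos k)).ne⟩
    refine ((hasDerivAt_iff_tendsto_slope.1 hd).comp ht).congr fun k => ?_
    have e : ∫ t in Icc (-L) 0, f t * ((hgi k).toL1 (g k)) t =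
        ∫ t in Icc (-L) 0, f t * g k t := by
      refine integral_congr_ae ?_
      filter_upwards [(hgi k).coeFn_toL1] with t ht
      rw [ht]
    rw [e, hint]
    simp only [Function.comp, slope_def_field, intervalIntegral.integral_same, sub_zero]
    rw [intervalIntegral.integral_symm (-h k) 0]
    field_simp

/-! ### Necessity: passage to the weak limit -/

namespace DelaySystem

variable {d m N : ℕ} {sys : DelaySystem d m N}

/-- Testing `Q * r + P * u` against a bounded continuous function. -/
lemma Steers.integral_eq {i : Fin d} {T C : ℝ} {r : ℝ → Fin d → ℝ} {u : ℝ → Fin m → ℝ}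
    {ρ : ℝ → ℝ} (h : sys.Steers i T C r u ρ) (f : ℝ →ᵇ ℝ) (l : Fin d) :
    (∫ t, f (t - sys.ΛN) * r t l) -
        ∑ j, ∑ q, sys.A j l q * (∫ t, f (t - sys.ΛN + sys.Λ j) * r t q) +
      ∑ q, sys.B l q * (∫ t, f t * u t q) =
    (1 : Matrix (Fin d) (Fin d) ℝ) l i * ∫ t in Icc (-sys.ΛN) 0, f t * ρ t := by
  have hbd : ∀ {v : ℝ → ℝ}, Integrable v → Integrable fun t => f t * v t := fun hv =>
    hv.bdd_mul f.continuous.aestronglyMeasurable (ae_of_all _ f.norm_coe_le_norm)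
  -- Translation invariance moves the delays from `r` to the test function, so the weak limit of `r`
  -- suffices.
  have hshift : ∀ (a : ℝ) (q : Fin d), ∫ t, f (t - a) * r t q = ∫ t, f t * r (t + a) q := by
    intro a q
    rw [← integral_add_right_eq_self (fun t => f (t - a) * r t q) a]
    simp only [add_sub_cancel_right]
  have e1 : ∀ t j, t - sys.ΛN + sys.Λ j = t - (sys.ΛN - sys.Λ j) := fun t j => by ring
  have i1 : Integrable fun t => f t * r (t + sys.ΛN) l :=
    hbd ((h.1.eval l).comp_add_right sys.ΛN)
  have i2 : ∀ j q, Integrable fun t => sys.A j l q * (f t * r (t + (sys.ΛN - sys.Λ j)) q) :=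
    fun j q => (hbd ((h.1.eval q).comp_add_right (sys.ΛN - sys.Λ j))).const_mul _
  have i3 : ∀ q, Integrable fun t => sys.B l q * (f t * u t q) :=
    fun q => (hbd (h.2.eval q)).const_mul _
  have i2' : Integrable fun t =>
      ∑ j, ∑ q, sys.A j l q * (f t * r (t + (sys.ΛN - sys.Λ j)) q) :=
    integrable_finsetSum _ fun j _ => integrable_finsetSum _ fun q _ => i2 j q
  have i3' : Integrable fun t => ∑ q, sys.B l q * (f t * u t q) :=
    integrable_finsetSum _ fun q _ => i3 q
  have i12 : Integrable fun t => f t * r (t + sys.ΛN) l -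
      ∑ j, ∑ q, sys.A j l q * (f t * r (t + (sys.ΛN - sys.Λ j)) q) := i1.sub i2'
  simp only [e1, hshift, ← integral_const_mul]
  rw [Finset.sum_congr rfl fun j _ => (integral_finsetSum _ fun q _ => i2 j q).symm,
    ← integral_finsetSum _ fun j _ => integrable_finsetSum _ fun q _ => i2 j q,
    ← integral_finsetSum _ fun q _ => i3 q, ← integral_sub i1 i2', ← integral_add i12 i3',
    ← integral_indicator measurableSet_Icc]
  refine integral_congr_ae ?_
  filter_upwards [h.7] with t ht
  have ht' := congrFun ht l
  have e2 : (Icc (-sys.ΛN) 0).indicator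
      (fun t => (1 : Matrix (Fin d) (Fin d) ℝ) l i * (f t * ρ t)) t =
      f t * (Pi.single i ((Icc (-sys.ΛN) 0).indicator ρ t) : Fin d → ℝ) l := by
    by_cases hI : t ∈ Icc (-sys.ΛN) 0
    · by_cases hl : l = i
      · subst hl; simp [indicator_of_mem hI]
      · simp [hl]
    · simp [indicator_of_notMem hI]
  rw [e2, ← ht']
  simp only [delayOp, Pi.add_apply, Pi.sub_apply, Finset.sum_apply, mulVec, dotProduct, mul_add,
    mul_sub, Finset.mul_sum, add_sub_assoc, mul_left_comm (f t)]

/-- Exact controllability gives a Bézout identity over `M(ℝ₋)`. -/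
theorem L1ExactlyControllable.exists_bezout (hc : sys.L1ExactlyControllable) :
    ∃ (R : Matrix (Fin d) (Fin d) (SignedMeasure ℝ)) (S : Matrix (Fin m) (Fin d) (SignedMeasure ℝ)),
      (∀ i j, MemMNeg (R i j)) ∧ (∀ i j, MemMNeg (S i j)) ∧
      matConv sys.Q R + matConv sys.P S = diracMatrix 0 (1 : Matrix (Fin d) (Fin d) ℝ) := by
  obtain ⟨ρ, hρ1, hρ⟩ := exists_approx_dirac sys.ΛN_pos
  choose T C hTC using hc.exists_uniform_steers
  choose ρ' r u hρ' hst using fun (i : Fin d) (k : ℕ) =>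
    hTC i (ρ k) (hρ1 k) (1 / ((k : ℝ) + 1)) (by positivity)
  have hlim : ∀ (i : Fin d) (f : ℝ →ᵇ ℝ),
      Tendsto (fun k => ∫ t in Icc (-sys.ΛN) 0, f t * ρ' i k t) atTop (𝓝 (f 0)) := by
    intro i f
    have hbd : ∀ v : Lp ℝ 1 (volume.restrict (Icc (-sys.ΛN) 0)),
        IntegrableOn (fun t => f t * v t) (Icc (-sys.ΛN) 0) := fun v =>
      (L1.integrable_coeFn v).bdd_mul f.continuous.aestronglyMeasurable
        (ae_of_all _ f.norm_coe_le_norm)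
    -- The `L¹` error `1/(k+1)` does not affect the weak limit `δ₀`.
    have hdiff : Tendsto (fun k => ∫ t in Icc (-sys.ΛN) 0, f t * (ρ' i k - ρ k) t) atTop (𝓝 0) := by
      refine squeeze_zero_norm (a := fun k : ℕ => ‖f‖ * (1 / ((k : ℝ) + 1))) (fun k => ?_) ?_
      · calc ‖∫ t in Icc (-sys.ΛN) 0, f t * (ρ' i k - ρ k) t‖
            ≤ ∫ t in Icc (-sys.ΛN) 0, ‖f‖ * ‖(ρ' i k - ρ k) t‖ := by
              refine norm_integral_le_of_norm_le ((L1.integrable_coeFn _).norm.const_mul _)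
                (ae_of_all _ fun t => ?_)
              rw [norm_mul]
              exact mul_le_mul_of_nonneg_right (f.norm_coe_le_norm t) (norm_nonneg _)
          _ = ‖f‖ * ‖ρ' i k - ρ k‖ := by rw [integral_const_mul, L1.norm_eq_integral_norm]
          _ ≤ _ := mul_le_mul_of_nonneg_left (hρ' i k) (norm_nonneg _)
      · simpa using tendsto_one_div_add_atTop_nhds_zero_nat.const_mul ‖f‖
    have := (hρ f).add hdiff
    rw [add_zero] at this
    refine this.congr fun k => ?_
    rw [← integral_add (hbd _) (hbd _)]
    refine integral_congr_ae ?_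
    filter_upwards [Lp.coeFn_sub (ρ' i k) (ρ k)] with t ht
    rw [ht, Pi.sub_apply]; ring
  -- One ultrafilter serves all entries and test functions, with no extraction of subsequences.
  choose R hR hRlim using fun (q i : Fin d) => exists_tendsto_signedMeasure (hyperfilter ℕ)
    (T := T i) (C := C i) (g := fun k t => r i k t q) (fun k => (hst i k).1.eval q)
    (fun k => (hst i k).3.mono fun t h ht => by simp [h ht]) (fun k => (hst i k).5 q)
  choose S hS hSlim using fun (q : Fin m) (i : Fin d) =>
    exists_tendsto_signedMeasure (hyperfilter ℕ)
    (T := T i) (C := C i) (g := fun k t => u i k t q) (fun k => (hst i k).2.eval q)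
    (fun k => (hst i k).4.mono fun t h ht => by simp [h ht]) (fun k => (hst i k).6 q)
  refine ⟨Matrix.of R, Matrix.of S, hR, hS, ?_⟩
  ext1 l i
  apply signedMeasure_ext
  intro f
  have ftr : ∀ a : ℝ, ∃ F : ℝ →ᵇ ℝ, ∀ t, F t = f (t + a) := fun a =>
    ⟨f.compContinuous ⟨fun t => t + a, by fun_prop⟩, fun t => rfl⟩
  obtain ⟨F, hF⟩ := ftr (-sys.ΛN)
  choose Fj hFj using fun j => ftr (-sys.ΛN + sys.Λ j)
  have hF' : (F : ℝ → ℝ) = fun t => f (t - sys.ΛN) := funext fun t => by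
    rw [hF, sub_eq_add_neg]
  have hFj' : ∀ j, (Fj j : ℝ → ℝ) = fun t => f (t - sys.ΛN + sys.Λ j) := fun j =>
    funext fun t => by rw [hFj, sub_eq_add_neg, add_assoc]
  have hl : (hyperfilter ℕ : Filter ℕ) ≤ atTop := Nat.hyperfilter_le_atTop
  have h1 := (((hRlim l i F).sub (tendsto_finsetSum Finset.univ fun j _ =>
    tendsto_finsetSum Finset.univ fun q _ => (hRlim q i (Fj j)).const_mul (sys.A j l q))).add
    (tendsto_finsetSum Finset.univ fun q _ => (hSlim q i f).const_mul (sys.B l q)))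
  have h2 := ((hlim i f).mono_left hl).const_mul ((1 : Matrix (Fin d) (Fin d) ℝ) l i)
  simp only [hF', hFj'] at h1
  have h3 := tendsto_nhds_unique h1 (h2.congr fun k => ((hst i k).integral_eq f l).symm)
  rw [sys.integral_bezout (Matrix.of R) (Matrix.of S) l i
    (fun q => by rw [← hF']; exact integrable_boundedContinuous _ F)
    (fun q j => by rw [← hFj' j]; exact integrable_boundedContinuous _ (Fj j))
    (fun q => integrable_boundedContinuous _ f)]
  simp only [of_apply]
  rw [h3, diracMatrix, of_apply, VectorMeasure.integral_dirac]
  simp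

end DelaySystem

end DelayControl

end

theorem mainTheorem5 {d m N : ℕ} (hd : 0 < d) (hm : 0 < m)
    (sys : DelayControl.DelaySystem d m N) :
    sys.L1ExactlyControllable ↔
      ∃ (R : Matrix (Fin d) (Fin d) (MeasureTheory.SignedMeasure ℝ))
        (S : Matrix (Fin m) (Fin d) (MeasureTheory.SignedMeasure ℝ)),
        (∀ i j, DelayControl.MemMNeg (R i j)) ∧
        (∀ i j, DelayControl.MemMNeg (S i j)) ∧
        DelayControl.matConv sys.Q R + DelayControl.matConv sys.P S =
          DelayControl.diracMatrix 0 (1 : Matrix (Fin d) (Fin d) ℝ) :=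
  ⟨fun h => h.exists_bezout, fun ⟨_, _, hR, hS, h⟩ => sys.l1ExactlyControllable_of_bezout hR hS h⟩
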